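/- For a finite graph $\Gamma$, let $\mathrm{cut}(\Gamma)$ be the minimum cardinality of a set $S$ of vertices such that every connected component of $\Gamma-S$ has at most $\frac12|V\Gamma|$ vertices. The separation profile of a graph $X$ is the function $\mathrm{sep}_X:\mathbb N\to\mathbb N$, $$\mathrm{sep}_X(r)=\max\{\mathrm{cut}(\Gamma) : \Gamma\text{ a finite subgraph of } X,\ |V\Gamma|\le r\}.$$ For $f,g:\mathbb N\to\mathbb N$ write $f\lesssim g$ if there is a constant $C\in\mathbb N$ with $f(r)\le C\,g(Cr)+C$ for all $r\in\mathbb N$, and $f\simeq g$ if $f\lesssim g$ and $g\lesssim f$. For a finitely generated group $G$, let $\mathrm{sep}_G$ denote the separation profile of the Cayley graph of $G$ with respect to any finite generating set. **Theorem.** Let $G$ and $H$ be finitely generated groups. Then the free product $G*H$ is finitely generated and $$\mathrm{sep}_{G*H}(r)\simeq\max\{\mathrm{sep}_G(r),\mathrm{sep}_H(r)\},$$ for every choice of finite generating sets of $G$, $H$ and $G*H$. -/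

import Mathlib

/-- `S` is a cutset of the finite graph `Γ`: every connected component of the graph `Γ - S`,
obtained by deleting the vertices in `S`, contains at most half of the vertices of `Γ`. -/
def SimpleGraph.IsCutset {V : Type*} (Γ : SimpleGraph V) (S : Finset V) : Prop :=
  ∀ C : (Γ.induce {v : V | v ∉ S}).ConnectedComponent, 2 * C.supp.ncard ≤ Nat.card V

/-- The cutsize of a finite graph: the minimum cardinality of a cutset
(the set of all vertices is always a cutset). -/
noncomputable def SimpleGraph.cutsize {V : Type*} (Γ : SimpleGraph V) : ℕ :=
  sInf {k : ℕ | ∃ S : Finset V, Γ.IsCutset S ∧ S.card = k}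

/-- The separation profile of a graph `X`: the maximum of the cutsizes of the finite subgraphs
of `X` with at most `r` vertices (a nonempty set of natural numbers bounded by `r`). -/
noncomputable def SimpleGraph.sepProfile {V : Type*} (X : SimpleGraph V) (r : ℕ) : ℕ :=
  sSup {k : ℕ | ∃ Γ : X.Subgraph, Γ.verts.Finite ∧ Γ.verts.ncard ≤ r ∧ Γ.coe.cutsize = k}

/-- `f ≲ g`: there is a constant `C` with `f r ≤ C * g (C * r) + C` for all `r`. -/
def CoarseLE (f g : ℕ → ℕ) : Prop :=
  ∃ C : ℕ, ∀ r : ℕ, f r ≤ C * g (C * r) + C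

/-- `f ≃ g`: both `f ≲ g` and `g ≲ f`. -/
def CoarseEquiv (f g : ℕ → ℕ) : Prop :=
  CoarseLE f g ∧ CoarseLE g f

/-- `S` is a finite generating set of the group `G`. -/
def IsFiniteGenSet {G : Type*} [Group G] (S : Finset G) : Prop :=
  Subgroup.closure (S : Set G) = ⊤

/-- The separation profile of the Cayley graph of `G` with respect to `S`. -/
noncomputable def groupSep {G : Type*} [Group G] (S : Finset G) : ℕ → ℕ :=
  (SimpleGraph.mulCayley (S : Set G)).sepProfile

/- Halving finite sets is as hard as cutting them with respect to arbitrary upward closed and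
pairwise intersecting families of heavy sets: if `s` vertices suffice to halve every subset of `K`,
then `9 * s` vertices suffice to leave no heavy connected piece in `K`. Indeed, if that failed, a
heavy set `D` of minimal `#D + M * #∂D` could be grown to a set `F` in which every superset of `D`
has a large boundary, and a halving separator of `F` would be too small for this.

Heavy families can be transported. Along an injective homomorphism `P → Q` this makes separation
profiles monotone. Given a finite connected set `K` in a Cayley graph of a free product, the heavy
family is projected to a coset `v * M i` and separated there. What remains heavy in `K` is then seen
through a single vertex `v * g` of the coset and lies in a branch at that vertex leading away from
`v`. Choosing at the start a smallest heavy branch gives a contradiction. -/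

open Finset SimpleGraph

section Connectivity

variable {V V' : Type*} {X : SimpleGraph V} {Y : SimpleGraph V'} {C : Set V}

lemma preconnected_induce_iff_forall_closed :
    (X.induce C).Preconnected ↔ ∀ D : Set V, (C ∩ D).Nonempty →
      (∀ x ∈ C ∩ D, ∀ y ∈ C, X.Adj x y → y ∈ D) → C ⊆ D := by
  refine ⟨fun hC D ⟨x, hx, hxD⟩ hD y hy => ?_, fun h x y => ?_⟩
  · have mem_of_walk : ∀ u v : C, (X.induce C).Walk u v → (u : V) ∈ D → (v : V) ∈ D := by
      intro u v p hu
      induction p with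
      | nil => exact hu
      | @cons a b _ hab _ ih => exact ih (hD a ⟨a.2, hu⟩ b b.2 hab)
    exact mem_of_walk _ _ (hC ⟨x, hx⟩ ⟨y, hy⟩).some hxD
  · obtain ⟨_, hxy⟩ := h {y | ∃ hy : y ∈ C, (X.induce C).Reachable x ⟨y, hy⟩}
      ⟨x, x.2, x.2, .rfl⟩ (fun u ⟨_, hu, hxu⟩ v hv huv =>
        ⟨hv, hxu.trans (Adj.reachable (G := X.induce C) (u := ⟨u, hu⟩) (v := ⟨v, hv⟩) huv)⟩) y.2
    exact hxy

lemma subset_of_connected_induce (hC : (X.induce C).Connected) {D : Set V}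
    (hne : (C ∩ D).Nonempty) (hD : ∀ x ∈ C ∩ D, ∀ y ∈ C, X.Adj x y → y ∈ D) : C ⊆ D :=
  preconnected_induce_iff_forall_closed.1 hC.preconnected D hne hD

lemma connected_induce_image (hC : (X.induce C).Connected) {f : V → V'}
    (hf : ∀ x ∈ C, ∀ y ∈ C, X.Adj x y → f x = f y ∨ Y.Adj (f x) (f y)) :
    (Y.induce (f '' C)).Connected := by
  have : Nonempty (f '' C) := (Set.nonempty_coe_sort.1 hC.nonempty).image f |>.to_subtype
  refine ⟨preconnected_induce_iff_forall_closed.2 ?_⟩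
  rintro D ⟨-, ⟨x, hx, rfl⟩, hxD⟩ hD
  refine Set.image_subset_iff.2 (subset_of_connected_induce hC ⟨x, hx, hxD⟩ ?_)
  rintro u ⟨hu, huD⟩ v hv huv
  obtain heq | hadj := hf u hu v hv huv
  · rwa [Set.mem_preimage, ← heq]
  · exact hD _ ⟨⟨u, hu, rfl⟩, huD⟩ _ ⟨v, hv, rfl⟩ hadj

lemma connected_induce_biUnion (hC : (X.induce C).Connected) {B : V → Set V'}
    (hB : ∀ x ∈ C, (Y.induce (B x)).Connected)
    (hadj : ∀ x ∈ C, ∀ y ∈ C, X.Adj x y → (B x ∩ B y).Nonempty) :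
    (Y.induce (⋃ x ∈ C, B x)).Connected := by
  have : Nonempty (⋃ x ∈ C, B x : Set V') := by
    obtain ⟨x, hx⟩ := Set.nonempty_coe_sort.1 hC.nonempty
    obtain ⟨z, hz⟩ := Set.nonempty_coe_sort.1 (hB x hx).nonempty
    exact ⟨z, Set.mem_biUnion hx hz⟩
  refine ⟨preconnected_induce_iff_forall_closed.2 ?_⟩
  rintro D ⟨z, hz, hzD⟩ hD
  have subset_of_inter : ∀ x ∈ C, (B x ∩ D).Nonempty → B x ⊆ D := fun x hx hne =>
    subset_of_connected_induce (hB x hx) hne fun u hu v hv =>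
      hD u ⟨Set.mem_biUnion hx hu.1, hu.2⟩ v (Set.mem_biUnion hx hv)
  obtain ⟨x, hx, hzx⟩ := Set.mem_iUnion₂.1 hz
  refine Set.iUnion₂_subset (subset_of_connected_induce (D := {x | B x ⊆ D}) hC
    ⟨x, hx, subset_of_inter x hx ⟨z, hzx, hzD⟩⟩ ?_)
  rintro u ⟨hu, huD⟩ v hv huv
  obtain ⟨w, hwu, hwv⟩ := hadj u hu v hv huv
  exact subset_of_inter v hv ⟨w, hwv, huD hwu⟩

lemma exists_connected_closed_of_subset (hC : (X.induce C).Connected) {L : Set V} (hCL : C ⊆ L) :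
    ∃ D, C ⊆ D ∧ D ⊆ L ∧ (X.induce D).Connected ∧ ∀ x ∈ D, ∀ y ∈ L, X.Adj x y → y ∈ D := by
  let 𝒞 : Set (Set V) := {B | C ⊆ B ∧ B ⊆ L ∧ (X.induce B).Connected}
  have hC𝒞 : C ∈ 𝒞 := ⟨subset_rfl, hCL, hC⟩
  refine ⟨⋃₀ 𝒞, Set.subset_sUnion_of_mem hC𝒞, Set.sUnion_subset fun B hB => hB.2.1, ?_, ?_⟩
  · refine X.induce_sUnion_connected_of_pairwise_not_disjoint ⟨C, hC𝒞⟩ ?_ fun hB => hB.2.2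
    exact fun hs ht => (Set.nonempty_coe_sort.1 hC.nonempty).mono (Set.subset_inter hs.1 ht.1)
  · rintro x ⟨B, ⟨hCB, hBL, hB⟩, hx⟩ y hy hxy
    have hBy : (X.induce (B ∪ {y})).Connected :=
      connected_induce_union hB.preconnected .of_subsingleton hx rfl hxy
    exact ⟨B ∪ {y}, ⟨hCB.trans Set.subset_union_left,
      Set.union_subset hBL (Set.singleton_subset_iff.2 hy), hBy⟩, .inr rfl⟩

end Connectivity

section Separators

variable {V : Type*} {X : SimpleGraph V}

/-- `Z` separates `K` with respect to `ℋ`: no connected subset of `K` avoiding `Z` belongs to `ℋ`.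
The members of `ℋ` are thought of as the heavy sets. Being heavy is an abstract property because,
when families are pushed forward, only upward closure and pairwise intersection survive. -/
def Separates (X : SimpleGraph V) (K Z : Finset V) (ℋ : Set (Set V)) : Prop :=
  ∀ C : Set V, C ⊆ K → Disjoint C Z → (X.induce C).Connected → C ∉ ℋ

/-- The sets containing more than half of `K`, the heavy sets in the definition of `cutsize`. -/
def majority (K : Finset V) : Set (Set V) :=
  {C | #K < 2 * (↑K ∩ C).ncard}

lemma isUpperSet_majority (K : Finset V) : IsUpperSet (majority K) := fun _ _ hCD hC =>
  lt_of_lt_of_le hC <| Nat.mul_le_mul_left 2 <|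
    Set.ncard_le_ncard (Set.inter_subset_inter_right _ hCD) (K.finite_toSet.inter_of_left _)

lemma intersecting_majority (K : Finset V) : (majority K).Intersecting := by
  intro A hA B hB hAB
  have hunion : (↑K ∩ A).ncard + (↑K ∩ B).ncard ≤ #K := by
    rw [← Set.ncard_union_eq (hAB.mono Set.inter_subset_right Set.inter_subset_right)
      (K.finite_toSet.inter_of_left _) (K.finite_toSet.inter_of_left _),
      ← Set.inter_union_distrib_left, ← Set.ncard_coe_finset K]
    exact Set.ncard_le_ncard Set.inter_subset_left K.finite_toSet
  simp only [majority, Set.mem_ofPred_eq] at hA hB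
  omega

lemma intersecting_preimage_preimage {V' : Type*} {ℋ : Set (Set V)} (hℋ : ℋ.Intersecting)
    (f : V → V') : (Set.preimage f ⁻¹' ℋ).Intersecting :=
  fun _ hS _ hT hST => hℋ hS hT (hST.preimage f)

lemma not_separates_iff {K Z : Finset V} {ℋ : Set (Set V)} :
    ¬ Separates X K Z ℋ ↔
      ∃ C : Set V, C ⊆ K ∧ Disjoint C Z ∧ (X.induce C).Connected ∧ C ∈ ℋ := by
  simp [Separates]

lemma exists_connected_of_not_separates {ℋ : Set (Set V)} (hℋ : ℋ.Intersecting) {K Z : Finset V}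
    (h : ¬ Separates X K Z ℋ) :
    ∃ K₀ ⊆ K, (X.induce (K₀ : Set V)).Connected ∧
      ∀ {Z' : Finset V}, Separates X K₀ Z' ℋ → Separates X K Z' ℋ := by
  obtain ⟨C, hCK, -, hC, hCℋ⟩ := not_separates_iff.1 h
  obtain ⟨D, hCD, hDK, hD, hDclosed⟩ := exists_connected_closed_of_subset hC hCK
  obtain ⟨K₀, rfl⟩ := (K.finite_toSet.subset hDK).exists_finset_coe
  refine ⟨K₀, coe_subset.1 hDK, hD, fun hZ' C' hC'K hC'Z' hC' hC'ℋ => ?_⟩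
  have hmeet : (C' ∩ K₀).Nonempty :=
    (Set.not_disjoint_iff_nonempty_inter.1 (hℋ hC'ℋ hCℋ)).mono (Set.inter_subset_inter_right _ hCD)
  have hC'K₀ : C' ⊆ K₀ := subset_of_connected_induce hC' hmeet fun x hx y hy =>
    hDclosed x hx.2 y (hC'K hy)
  exact hZ' C' hC'K₀ hC'Z' hC' hC'ℋ

lemma cutsize_le_of_isCutset {Γ : SimpleGraph V} {S : Finset V} (hS : Γ.IsCutset S) :
    Γ.cutsize ≤ #S :=
  Nat.sInf_le ⟨S, hS, rfl⟩

lemma isCutset_univ [Fintype V] (Γ : SimpleGraph V) : Γ.IsCutset univ := by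
  intro C
  obtain ⟨⟨v, hv⟩, -⟩ := C.nonempty_supp
  exact absurd (mem_univ v) hv

lemma exists_isCutset_card_eq_cutsize [Finite V] (Γ : SimpleGraph V) :
    ∃ S : Finset V, Γ.IsCutset S ∧ #S = Γ.cutsize := by
  have := Fintype.ofFinite V
  exact Nat.sInf_mem (s := {k : ℕ | ∃ S : Finset V, Γ.IsCutset S ∧ #S = k})
    ⟨_, univ, isCutset_univ Γ, rfl⟩

lemma cutsize_coe_le_sepProfile (Γ : X.Subgraph) (hfin : Γ.verts.Finite) {r : ℕ}
    (hr : Γ.verts.ncard ≤ r) : Γ.coe.cutsize ≤ X.sepProfile r := by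
  refine le_csSup ⟨r, ?_⟩ ⟨Γ, hfin, hr, rfl⟩
  rintro k ⟨Δ, hΔ, hΔr, rfl⟩
  have := hΔ.fintype
  refine (cutsize_le_of_isCutset (isCutset_univ Δ.coe)).trans ?_
  rwa [card_univ, ← Nat.card_eq_fintype_card, Nat.card_coe_set_eq]

lemma isCutset_coe_of_separates {Γ : X.Subgraph} {K Z : Finset V}
    [DecidablePred (· ∈ Γ.verts)] (hK : (K : Set V) = Γ.verts)
    (hZ : Separates X K Z (majority K)) : Γ.coe.IsCutset (Z.subtype (· ∈ Γ.verts)) := by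
  intro C
  set e : {v : Γ.verts | v ∉ Z.subtype (· ∈ Γ.verts)} → V := fun v => v
  have einj : Function.Injective e := Subtype.val_injective.comp Subtype.val_injective
  have hCK : e '' C.supp ⊆ K := by
    rintro - ⟨v, -, rfl⟩
    exact hK ▸ v.1.2
  have hCZ : Disjoint (e '' C.supp) Z := by
    rw [Set.disjoint_left]
    rintro - ⟨v, -, rfl⟩ hvZ
    exact v.2 (mem_subtype.2 hvZ)
  have hC : (X.induce (e '' C.supp)).Connected :=
    connected_induce_image C.connected_toSimpleGraph fun _ _ _ _ h => .inr (Γ.adj_sub h)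
  have hhalf := hZ _ hCK hCZ hC
  rwa [majority, Set.mem_ofPred_eq, not_lt, Set.inter_eq_right.2 hCK,
    Set.ncard_image_of_injective _ einj, ← Set.ncard_coe_finset, hK,
    ← Nat.card_coe_set_eq Γ.verts] at hhalf

lemma separates_of_isCutset_coe {Γ : X.Subgraph} (hΓ : Γ.IsInduced) {K : Finset V}
    (hK : Γ.verts = K) {S : Finset Γ.verts} (hS : Γ.coe.IsCutset S) :
    Separates X K (S.map (.subtype _)) (majority K) := by
  intro C hCK hCS hC
  rw [← hK] at hCK
  have : Finite Γ.verts := hK ▸ K.finite_toSet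
  have notMem : ∀ v (hv : v ∈ C), (⟨v, hCK hv⟩ : Γ.verts) ∉ S := fun v hv hvS =>
    Set.disjoint_left.1 hCS hv (mem_map_of_mem (.subtype _) hvS)
  obtain ⟨x, hx⟩ := Set.nonempty_coe_sort.1 hC.nonempty
  set A := (Γ.coe.induce {v | v ∉ S}).connectedComponentMk ⟨⟨x, hCK hx⟩, notMem x hx⟩
  have hCA : C ⊆ (fun v : {v : Γ.verts | v ∉ S} => (v.1 : V)) '' A.supp := by
    refine subset_of_connected_induce hC ⟨x, hx, _, rfl, rfl⟩ ?_
    rintro - ⟨hu, u, huA, rfl⟩ v hv huv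
    refine ⟨⟨⟨v, hCK hv⟩, notMem v hv⟩, ?_, rfl⟩
    refine (ConnectedComponent.sound (Adj.reachable ?_)).trans huA
    exact hΓ (hCK hv) (hCK hu) huv.symm
  have hle : (Γ.verts ∩ C).ncard ≤ A.supp.ncard := by
    rw [Set.inter_eq_right.2 hCK]
    exact (Set.ncard_le_ncard hCA (Set.toFinite _)).trans (Set.ncard_image_le (Set.toFinite _))
  rw [majority, Set.mem_ofPred_eq, not_lt, ← Set.ncard_coe_finset, ← hK, ← Nat.card_coe_set_eq]
  exact (Nat.mul_le_mul_left 2 hle).trans (hS A)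

theorem sepProfile_le_of_forall_separates {r m : ℕ}
    (h : ∀ K : Finset V, #K ≤ r → ∃ Z : Finset V, #Z ≤ m ∧ Separates X K Z (majority K)) :
    X.sepProfile r ≤ m := by
  classical
  refine csSup_le' ?_
  rintro k ⟨Γ, hfin, hr, rfl⟩
  obtain ⟨Z, hZm, hZ⟩ := h hfin.toFinset (by rwa [← Set.ncard_eq_toFinset_card _ hfin])
  calc Γ.coe.cutsize
      ≤ #(Z.subtype (· ∈ Γ.verts)) :=
        cutsize_le_of_isCutset (isCutset_coe_of_separates hfin.coe_toFinset hZ)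
    _ ≤ #Z := (card_subtype _ _).trans_le (card_filter_le _ _)
    _ ≤ m := hZm

theorem exists_separates_majority {K : Finset V} {r : ℕ} (hK : #K ≤ r) :
    ∃ Z : Finset V, #Z ≤ X.sepProfile r ∧ Separates X K Z (majority K) := by
  let Γ : X.Subgraph := (⊤ : X.Subgraph).induce K
  have hverts : Γ.verts = K := rfl
  have : Finite Γ.verts := K.finite_toSet
  obtain ⟨S, hS, hScard⟩ := exists_isCutset_card_eq_cutsize Γ.coe
  refine ⟨S.map (.subtype _), ?_, separates_of_isCutset_coe ?_ hverts hS⟩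
  · rw [card_map, hScard]
    exact cutsize_coe_le_sepProfile Γ K.finite_toSet (by rwa [hverts, Set.ncard_coe_finset])
  · exact fun _ hu _ hv huv => ⟨hu, hv, huv⟩

lemma monotone_sepProfile (X : SimpleGraph V) : Monotone X.sepProfile := fun _ _ hrs =>
  sepProfile_le_of_forall_separates fun _ hK => exists_separates_majority (hK.trans hrs)

end Separators

section HeavyFamilies

variable {V : Type*} {X : SimpleGraph V} {K D F : Finset V} {M : ℕ}

open scoped Classical in
/-- The vertices of `K` outside `D` that have a neighbour in `D`. -/
noncomputable def outerBoundary (X : SimpleGraph V) (K D : Finset V) : Finset V :=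
  {y ∈ K | y ∉ D ∧ ∃ x ∈ D, X.Adj x y}

/-- The size of `D` plus `M` for each vertex of its outer boundary in `K`, a submodular function of
`D` whose minimizers are used to find sets that are hard to separate. -/
noncomputable def boundaryCost (X : SimpleGraph V) (M : ℕ) (K D : Finset V) : ℕ :=
  #D + M * #(outerBoundary X K D)

/-- `F` expands from `D`: no set between `D` and `F` costs less than `F` itself, so that every such
set misses at most `M` vertices of `F` for each vertex of its boundary in `F`. -/
def IsExpanding (X : SimpleGraph V) (M : ℕ) (D F : Finset V) : Prop :=
  ∀ E, D ⊆ E → E ⊆ F → #F ≤ boundaryCost X M F E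

lemma mem_outerBoundary {y : V} :
    y ∈ outerBoundary X K D ↔ y ∈ K ∧ y ∉ D ∧ ∃ x ∈ D, X.Adj x y := by
  simp [outerBoundary]

lemma outerBoundary_mono (hFK : F ⊆ K) : outerBoundary X F D ⊆ outerBoundary X K D := fun _ hy =>
  mem_outerBoundary.2 ⟨hFK (mem_outerBoundary.1 hy).1, (mem_outerBoundary.1 hy).2⟩

@[simp]
lemma outerBoundary_self : outerBoundary X K K = ∅ := by
  ext
  simp +contextual [mem_outerBoundary]

@[simp]
lemma boundaryCost_self : boundaryCost X M K K = #K := by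
  simp [boundaryCost]

lemma boundaryCost_mono_left {M' : ℕ} (h : M ≤ M') :
    boundaryCost X M K D ≤ boundaryCost X M' K D := by
  unfold boundaryCost
  gcongr

lemma card_le_boundaryCost : #D ≤ boundaryCost X M K D :=
  Nat.le_add_right _ _

section Submodularity

variable [DecidableEq V]

lemma card_outerBoundary_union_add_inter_le (A B : Finset V) :
    #(outerBoundary X K (A ∪ B)) + #(outerBoundary X K (A ∩ B)) ≤
      #(outerBoundary X K A) + #(outerBoundary X K B) := by
  rw [← card_union_add_card_inter, ← card_union_add_card_inter (outerBoundary X K A)]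
  refine add_le_add (card_le_card fun y hy => ?_) (card_le_card fun y hy => ?_)
  all_goals
    simp only [mem_union, mem_inter, mem_outerBoundary] at hy ⊢
    grind

lemma boundaryCost_union_add_inter_le (A B : Finset V) :
    boundaryCost X M K (A ∪ B) + boundaryCost X M K (A ∩ B) ≤
      boundaryCost X M K A + boundaryCost X M K B := by
  have hcard := card_union_add_card_inter A B
  have hboundary := Nat.mul_le_mul_left M
    (card_outerBoundary_union_add_inter_le (X := X) (K := K) A B)
  simp only [boundaryCost, mul_add] at hboundary ⊢
  omega

end Submodularity

lemma isExpanding_self : IsExpanding X M D D := fun E hDE hED => by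
  rw [hED.antisymm hDE, boundaryCost_self]

lemma IsExpanding.exists_least_tight (hF : IsExpanding X M D F) (hDF : D ⊆ F) :
    ∃ E, D ⊆ E ∧ E ⊆ F ∧ boundaryCost X M F E = #F ∧
      ∀ E', D ⊆ E' → E' ⊆ F → boundaryCost X M F E' = #F → E ⊆ E' := by
  classical
  obtain ⟨E, hE, hmin⟩ := exists_min_image
    {E ∈ F.powerset | D ⊆ E ∧ boundaryCost X M F E = #F} card ⟨F, by simp [hDF]⟩
  simp only [mem_filter, mem_powerset] at hE hmin
  obtain ⟨hEF, hDE, htight⟩ := hE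
  refine ⟨E, hDE, hEF, htight, fun E' hDE' hEF' htight' => ?_⟩
  have hunion := hF (E ∪ E') (hDE.trans subset_union_left) (union_subset hEF hEF')
  have hinter := hF (E ∩ E') (subset_inter hDE hDE') (inter_subset_left.trans hEF)
  have hsub := boundaryCost_union_add_inter_le (X := X) (M := M) (K := F) E E'
  have hle := hmin (E ∩ E') ⟨inter_subset_left.trans hEF, subset_inter hDE hDE', by omega⟩
  exact inter_eq_left.1 (eq_of_subset_of_card_le inter_subset_left hle)

section Insert

variable [DecidableEq V] {E : Finset V} {b : V}

lemma boundaryCost_erase_lt (hbF : b ∉ F) (hbE : b ∈ E) :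
    boundaryCost X M F (E.erase b) < boundaryCost X M (insert b F) E := by
  have hsub : outerBoundary X F (E.erase b) ⊆ outerBoundary X (insert b F) E := by
    intro y
    simp only [mem_outerBoundary, mem_erase, mem_insert]
    grind
  have hcard := Nat.mul_le_mul_left M (card_le_card hsub)
  have herase := card_erase_add_one hbE
  unfold boundaryCost
  omega

lemma boundaryCost_le_insert : boundaryCost X M F E ≤ boundaryCost X M (insert b F) E := by
  unfold boundaryCost
  gcongr
  exact outerBoundary_mono (subset_insert b F)

lemma boundaryCost_lt_insert (hM : 0 < M) (hbF : b ∉ F) (hbE : b ∉ E) (hadj : ∃ x ∈ E, X.Adj x b) :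
    boundaryCost X M F E < boundaryCost X M (insert b F) E := by
  have hssub : outerBoundary X F E ⊂ outerBoundary X (insert b F) E :=
    (ssubset_iff_of_subset (outerBoundary_mono (subset_insert b F))).2
      ⟨b, mem_outerBoundary.2 ⟨mem_insert_self b F, hbE, hadj⟩,
        fun hb => hbF (mem_outerBoundary.1 hb).1⟩
  exact Nat.add_lt_add_left (Nat.mul_lt_mul_of_pos_left (card_lt_card hssub) hM) _

lemma IsExpanding.exists_insert (hF : IsExpanding X M D F) (hM : 0 < M)
    (hDF : D ⊆ F) (hFK : F ⊆ K) (hlt : ∀ E, D ⊆ E → E ⊆ K → #F < boundaryCost X M K E) :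
    ∃ b ∈ K, b ∉ F ∧ IsExpanding X M D (insert b F) := by
  obtain ⟨E, hDE, hEF, htight, hleast⟩ := hF.exists_least_tight hDF
  have hE : #(outerBoundary X F E) < #(outerBoundary X K E) :=
    lt_of_mul_lt_mul_left (lt_of_add_lt_add_left (htight.trans_lt (hlt E hDE (hEF.trans hFK))))
      M.zero_le
  obtain ⟨b, hbK, hbE⟩ := exists_mem_notMem_of_card_lt_card hE
  simp only [mem_outerBoundary, not_and] at hbK hbE
  obtain ⟨hbK, hbE', x, hx, hxb⟩ := hbK
  have hbF : b ∉ F := fun h => hbE h hbE' ⟨x, hx, hxb⟩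
  refine ⟨b, hbK, hbF, fun E' hDE' hEF' => ?_⟩
  rw [card_insert_of_notMem hbF, Nat.succ_le_iff]
  by_cases hbE' : b ∈ E'
  · exact (hF (E'.erase b) (subset_erase.2 ⟨hDE', fun h => hbF (hDF h)⟩)
      (subset_insert_iff.1 hEF')).trans_lt (boundaryCost_erase_lt hbF hbE')
  have hEF'' : E' ⊆ F := (subset_insert_iff_of_notMem hbE').1 hEF'
  obtain htight' | hslack := (hF E' hDE' hEF'').eq_or_lt
  · have hxE' : x ∈ E' := hleast E' hDE' hEF'' htight'.symm hx
    exact htight'.trans_lt (boundaryCost_lt_insert hM hbF hbE' ⟨x, hxE', hxb⟩)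
  · exact hslack.trans_le boundaryCost_le_insert

end Insert

-- `F` is grown from `D` one vertex at a time. By submodularity there is a least set whose cost
-- equals the size of `F`, and adding a vertex of its boundary raises the cost of every such set.
theorem exists_isExpanding_card_eq (hM : 0 < M) (hDK : D ⊆ K)
    (hmin : ∀ E, D ⊆ E → E ⊆ K → boundaryCost X M K D ≤ boundaryCost X M K E) :
    ∃ F, D ⊆ F ∧ F ⊆ K ∧ IsExpanding X M D F ∧ #F = boundaryCost X M K D := by
  classical
  obtain ⟨F, hF, hmax⟩ := exists_max_image
    {F ∈ K.powerset | D ⊆ F ∧ IsExpanding X M D F ∧ #F ≤ boundaryCost X M K D} card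
    ⟨D, by simp [hDK, isExpanding_self, card_le_boundaryCost]⟩
  simp only [mem_filter, mem_powerset] at hF hmax
  obtain ⟨hFK, hDF, hexp, hcard⟩ := hF
  refine ⟨F, hDF, hFK, hexp, hcard.antisymm (not_lt.1 fun hlt => ?_)⟩
  obtain ⟨b, hbK, hbF, hexp'⟩ := hexp.exists_insert hM hDF hFK
    fun E hDE hEK => hlt.trans_le (hmin E hDE hEK)
  have hcard' := card_insert_of_notMem hbF
  have := hmax (insert b F) ⟨insert_subset hbK hFK, hDF.trans (subset_insert b F), hexp',
    by omega⟩
  omega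

lemma outerBoundary_subset_of_isExpanding (hexp : IsExpanding X M D F) (hM : 0 < M) (hDF : D ⊆ F)
    (hFK : F ⊆ K) (hcard : #F = boundaryCost X M K D) : outerBoundary X K D ⊆ F := by
  have hle : #(outerBoundary X K D) ≤ #(outerBoundary X F D) :=
    le_of_mul_le_mul_left (le_of_add_le_add_left (hcard ▸ hexp D subset_rfl hDF)) hM
  rw [← eq_of_subset_of_card_le (outerBoundary_mono hFK) hle]
  exact fun y hy => (mem_outerBoundary.1 hy).1

-- Compare `F` with `C ∪ D` and `D` with `C ∩ D`. Up to `Z`, the boundaries of these two sets are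
-- the parts of the boundary of `D` outside and inside `C`, so only `Z` is counted twice.
lemma IsExpanding.card_le_of_outerBoundary_subset [DecidableEq V] (hexp : IsExpanding X M D F)
    (hM : 0 < M) (hDF : D ⊆ F) (hFK : F ⊆ K) (hcard : #F = boundaryCost X M K D) {C Z : Finset V}
    (hCF : C ⊆ F) (hCZ : outerBoundary X F C ⊆ Z)
    (hmin : boundaryCost X M K D ≤ boundaryCost X M K (C ∩ D)) : #F ≤ #C + 2 * M * #Z := by
  have hsub := outerBoundary_subset_of_isExpanding hexp hM hDF hFK hcard
  set B := outerBoundary X K D with hB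
  have hinter : outerBoundary X K (C ∩ D) ⊆ Z ∪ B ∩ C := by
    intro y hy
    have hyF : y ∈ F := by
      by_cases hyD : y ∈ D
      · exact hDF hyD
      · refine hsub (mem_outerBoundary.2 ?_)
        simp only [mem_outerBoundary, mem_inter] at hy
        grind
    have hyZ := @hCZ y
    simp only [mem_outerBoundary, mem_union, mem_inter, hB] at hy hyZ ⊢
    grind
  have hunion : outerBoundary X F (C ∪ D) ⊆ Z ∪ B \ C := by
    intro y hy
    have hyZ := @hCZ y
    simp only [mem_outerBoundary, mem_union, mem_sdiff, hB] at hy hyZ ⊢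
    grind
  have hboundary : #(outerBoundary X K (C ∩ D)) + #(outerBoundary X F (C ∪ D)) ≤ 2 * #Z + #B := by
    have h1 := (card_le_card hinter).trans (card_union_le _ _)
    have h2 := (card_le_card hunion).trans (card_union_le _ _)
    have h3 := card_inter_add_card_sdiff B C
    omega
  have hexpCD := hexp (C ∪ D) subset_union_right (union_subset hCF hDF)
  have hCD := card_union_add_card_inter C D
  have := Nat.mul_le_mul_left M hboundary
  unfold boundaryCost at *
  nlinarith

-- `M` is the last multiplier for which all heavy sets cost more than `4 * s * M`. The heavy set
-- that is cheap for `M + 1` bounds the boundary of the set `D` that is cheapest for `M`.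
lemma exists_minimal_boundaryCost {ℋ : Set (Set V)} {s : ℕ} (hs : 0 < s) (hK : (K : Set V) ∈ ℋ)
    (hcard : ∀ D ⊆ K, (D : Set V) ∈ ℋ → 4 * s < #D) :
    ∃ M D, 0 < M ∧ D ⊆ K ∧ (D : Set V) ∈ ℋ ∧
      (∀ E ⊆ K, (E : Set V) ∈ ℋ → boundaryCost X M K D ≤ boundaryCost X M K E) ∧
      4 * s * M < boundaryCost X M K D ∧ #(outerBoundary X K D) ≤ 8 * s := by
  classical
  let P : ℕ → Prop := fun M => ∀ E ⊆ K, (E : Set V) ∈ ℋ → 4 * s * M < boundaryCost X M K E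
  obtain ⟨M, hM, hPM, hPM'⟩ : ∃ M, 0 < M ∧ P M ∧ ¬ P (M + 1) := by
    by_contra! hstep
    have hP1 : P 1 := fun E hEK hE => by
      have := (hcard E hEK hE).trans_le (card_le_boundaryCost (X := X) (M := 1) (K := K))
      omega
    have hP : ∀ M, 0 < M → P M := fun M hM => Nat.le_induction (P := fun M _ => P M) hP1 hstep M hM
    have hlt := hP (#K + 1) (Nat.succ_pos _) K subset_rfl hK
    rw [boundaryCost_self] at hlt
    nlinarith
  obtain ⟨D, hD, hmin⟩ := exists_min_image (K.powerset.filter fun E : Finset V => (E : Set V) ∈ ℋ)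
    (boundaryCost X M K) ⟨K, by simp [hK]⟩
  simp only [mem_filter, mem_powerset, and_imp] at hD hmin
  refine ⟨M, D, hM, hD.1, hD.2, hmin, hPM D hD.1 hD.2, ?_⟩
  obtain ⟨E, hEK, hE, hEM⟩ : ∃ E ⊆ K, (E : Set V) ∈ ℋ ∧ boundaryCost X (M + 1) K E ≤
      4 * s * (M + 1) := by simpa [P] using hPM'
  refine le_of_mul_le_mul_left ?_ hM
  calc M * #(outerBoundary X K D)
      ≤ boundaryCost X M K D := Nat.le_add_left _ _
    _ ≤ boundaryCost X M K E := hmin E hEK hE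
    _ ≤ boundaryCost X (M + 1) K E := boundaryCost_mono_left M.le_succ
    _ ≤ 4 * s * (M + 1) := hEM
    _ ≤ M * (8 * s) := by nlinarith

lemma exists_heavy_connected_subset {ℋ : Set (Set V)} (hint : ℋ.Intersecting)
    (hD : (D : Set V) ∈ ℋ) {Z : Finset V} (hZ : outerBoundary X K D ⊆ Z)
    (hsep : ¬ Separates X K Z ℋ) :
    ∃ C ⊆ D, Disjoint C Z ∧ (X.induce (C : Set V)).Connected ∧ (C : Set V) ∈ ℋ := by
  obtain ⟨C, hCK, hCZ, hC, hCℋ⟩ := not_separates_iff.1 hsep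
  lift C to Finset V using K.finite_toSet.subset hCK
  rw [disjoint_coe] at hCZ
  have hCD : (C : Set V) ⊆ D := by
    refine subset_of_connected_induce hC (Set.not_disjoint_iff_nonempty_inter.1 (hint hCℋ hD)) ?_
    rintro x ⟨-, hxD⟩ y hyC hxy
    by_contra hyD
    exact Finset.disjoint_left.1 hCZ hyC
      (hZ (mem_outerBoundary.2 ⟨hCK hyC, hyD, x, hxD, hxy⟩))
  exact ⟨C, coe_subset.1 hCD, hCZ, hC, hCℋ⟩

lemma exists_superset_card_le_half {C Z : Finset V} (hCF : C ⊆ F) (hCZ : Disjoint C Z)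
    (hC : (X.induce (C : Set V)).Connected) (hZ : Separates X F Z (majority F)) :
    ∃ A, C ⊆ A ∧ A ⊆ F ∧ outerBoundary X F A ⊆ Z ∧ 2 * #A ≤ #F := by
  obtain ⟨A, hCA, hAL, hA, hclosed⟩ := exists_connected_closed_of_subset hC
    (L := (F : Set V) \ Z) (Set.subset_sdiff.2 ⟨coe_subset.2 hCF, disjoint_coe.2 hCZ⟩)
  lift A to Finset V using F.finite_toSet.sdiff.subset hAL
  obtain ⟨hAF, hAZ⟩ := Set.subset_sdiff.1 hAL
  refine ⟨A, coe_subset.1 hCA, coe_subset.1 hAF, fun y hy => ?_, ?_⟩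
  · obtain ⟨hyF, hyA, x, hx, hxy⟩ := mem_outerBoundary.1 hy
    by_contra hyZ
    exact hyA (hclosed x hx y ⟨hyF, hyZ⟩ hxy)
  · have hhalf := hZ A hAF hAZ hA
    rwa [majority, Set.mem_ofPred_eq, not_lt, Set.inter_eq_right.2 hAF,
      Set.ncard_coe_finset] at hhalf

theorem exists_separates_of_forall_majority {ℋ : Set (Set V)} (hup : IsUpperSet ℋ)
    (hint : ℋ.Intersecting) {s : ℕ} (hs : 0 < s)
    (hsep : ∀ F ⊆ K, ∃ Z : Finset V, #Z ≤ s ∧ Separates X F Z (majority F)) :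
    ∃ Z : Finset V, #Z ≤ 9 * s ∧ Separates X K Z ℋ := by
  classical
  by_contra! hno
  obtain ⟨C₀, hC₀K, -, -, hC₀⟩ := not_separates_iff.1 (hno ∅ (by simp))
  have hcard : ∀ D ⊆ K, (D : Set V) ∈ ℋ → 4 * s < #D := fun D _ hD => by
    by_contra! hle
    refine hno D (by omega) fun C _ hCD _ hC => hint hC hD hCD
  obtain ⟨M, D, hM, hDK, hD, hmin, hlt, hboundary⟩ :=
    exists_minimal_boundaryCost (X := X) hs (hup hC₀K hC₀) hcard
  obtain ⟨F, hDF, hFK, hexp, hFcard⟩ := exists_isExpanding_card_eq hM hDK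
    fun E hDE hEK => hmin E hEK (hup (coe_subset.2 hDE) hD)
  obtain ⟨Z, hZs, hZ⟩ := hsep F hFK
  obtain ⟨C, hCD, hCZ, hC, hCℋ⟩ := exists_heavy_connected_subset hint hD subset_union_right
    (hno (Z ∪ outerBoundary X K D) ((card_union_le _ _).trans (by omega)))
  obtain ⟨A, hCA, hAF, hAZ, hhalf⟩ := exists_superset_card_le_half (hCD.trans hDF)
    (disjoint_union_right.1 hCZ).1 hC hZ
  have hA : ((A ∩ D : Finset V) : Set V) ∈ ℋ := hup (coe_subset.2 (subset_inter hCA hCD)) hCℋ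
  have hF := hexp.card_le_of_outerBoundary_subset hM hDF hFK hFcard hAF hAZ
    (hmin _ (inter_subset_right.trans hDK) hA)
  nlinarith

theorem exists_separates_of_sepProfile_le {ℋ : Set (Set V)} (hup : IsUpperSet ℋ)
    (hint : ℋ.Intersecting) {r s : ℕ} (hs : 0 < s) (hr : X.sepProfile r ≤ s) (hK : #K ≤ r) :
    ∃ Z : Finset V, #Z ≤ 9 * s ∧ Separates X K Z ℋ :=
  exists_separates_of_forall_majority hup hint hs fun _ hFK =>
    let ⟨Z, hZ, hsep⟩ := exists_separates_majority ((card_le_card hFK).trans hK)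
    ⟨Z, hZ.trans hr, hsep⟩

end HeavyFamilies

section Comparison

theorem coarseLE_sepProfile_of_connected_family {V V' : Type*} {X : SimpleGraph V}
    {Y : SimpleGraph V'} {N : ℕ} (B : V → Finset V')
    (hconn : ∀ x, (Y.induce (B x : Set V')).Connected)
    (hadj : ∀ x y, X.Adj x y → ((B x : Set V') ∩ B y).Nonempty) (hcard : ∀ x, #(B x) ≤ N)
    (hmult : ∀ z, {x | z ∈ B x}.encard ≤ N) : CoarseLE X.sepProfile Y.sepProfile := by
  classical
  refine ⟨9 * N, fun r => ?_⟩
  choose f hf using fun x => Set.nonempty_coe_sort.1 (hconn x).nonempty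
  rw [← Nat.mul_succ]
  refine sepProfile_le_of_forall_separates fun K hK => ?_
  have hK' : #(K.biUnion B) ≤ 9 * N * r :=
    calc #(K.biUnion B) ≤ #K * N := card_biUnion_le_card_mul _ _ _ fun x _ => hcard x
      _ ≤ 9 * N * r := by nlinarith
  obtain ⟨Z, hZcard, hZ⟩ := exists_separates_of_sepProfile_le
    ((isUpperSet_majority K).preimage Set.monotone_preimage)
    (intersecting_preimage_preimage (intersecting_majority K) f) (Nat.succ_pos _)
    (Nat.le_succ (Y.sepProfile (9 * N * r))) hK'
  refine ⟨{x ∈ K | ¬ Disjoint (B x) Z}, ?_, fun C hCK hCZ hC hCℋ => ?_⟩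
  · have hsub : {x ∈ K | ¬ Disjoint (B x) Z} ⊆ Z.biUnion fun z => {x ∈ K | z ∈ B x} := by
      intro x hx
      obtain ⟨hxK, hxZ⟩ := mem_filter.1 hx
      obtain ⟨z, hzx, hzZ⟩ := not_disjoint_iff.1 hxZ
      exact mem_biUnion.2 ⟨z, hzZ, mem_filter.2 ⟨hxK, hzx⟩⟩
    have hfibre : ∀ z ∈ Z, #{x ∈ K | z ∈ B x} ≤ N := fun z _ => by
      rw [← Nat.cast_le (α := ℕ∞), ← Set.encard_coe_eq_coe_finsetCard]
      refine (Set.encard_le_encard ?_).trans (hmult z)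
      exact fun x hx => (mem_filter.1 hx).2
    calc _ ≤ #Z * N := (card_le_card hsub).trans (card_biUnion_le_card_mul _ _ _ hfibre)
      _ ≤ 9 * N * (Y.sepProfile (9 * N * r)).succ := by nlinarith
  · have hBC : (Y.induce (⋃ x ∈ C, (B x : Set V'))).Connected :=
      connected_induce_biUnion hC (fun x _ => hconn x) fun x _ y _ => hadj x y
    have hBZ : Disjoint (⋃ x ∈ C, (B x : Set V')) Z := Set.disjoint_iUnion₂_left.2 fun x hx =>
      disjoint_coe.2 <| by_contra fun h =>
        Set.disjoint_left.1 hCZ hx (mem_coe.2 (mem_filter.2 ⟨hCK hx, h⟩))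
    refine hZ _ ?_ hBZ hBC (isUpperSet_majority K (fun x hx => ?_) hCℋ)
    · rw [coe_biUnion]
      exact Set.biUnion_subset_biUnion_left hCK
    · exact Set.mem_biUnion hx (hf x)

variable {P Q : Type*} [Group P] [Group Q]

lemma connected_mulCayley {U : Finset P} (hU : IsFiniteGenSet U) :
    (mulCayley (U : Set P)).Connected := by
  have reachable_mul : ∀ g a : P, (mulCayley (U : Set P)).Reachable a (a * g) := by
    intro g
    induction (hU ▸ Subgroup.mem_top g : g ∈ Subgroup.closure (U : Set P))
      using Subgroup.closure_induction with
    | mem u hu =>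
      intro a
      by_cases h : a = a * u
      · rw [← h]
      · exact Adj.reachable ((mulCayley_adj _ _ _).2 ⟨h, .inl (by simpa using hu)⟩)
    | one => exact fun a => by rw [mul_one]
    | mul x y _ _ hx hy => exact fun a => mul_assoc a x y ▸ (hx a).trans (hy (a * x))
    | inv x _ hx => exact fun a => by simpa using (hx (a * x⁻¹)).symm
  exact ⟨fun a b => by simpa using reachable_mul (a⁻¹ * b) a⟩

lemma connected_induce_image_mul_left {U : Set P} {C : Set P}
    (hC : ((mulCayley U).induce C).Connected) (g : P) :
    ((mulCayley U).induce ((g * ·) '' C)).Connected :=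
  connected_induce_image hC fun _ _ _ _ h => .inr (mulCayley_adj_mul_iff_right.2 h)

theorem groupSep_coarseLE_of_injective {f : P →* Q} (hf : Function.Injective f) (S : Finset P)
    {U : Finset Q} (hU : IsFiniteGenSet U) : CoarseLE (groupSep S) (groupSep U) := by
  classical
  obtain ⟨B, hB, hconn⟩ := extend_finset_to_connected (connected_mulCayley hU).preconnected
    (insert_nonempty 1 (S.image f))
  obtain ⟨h1, hS⟩ := insert_subset_iff.1 hB
  have self_mem : ∀ x, f x ∈ B.image (f x * ·) := fun x => mem_image.2 ⟨1, h1, mul_one _⟩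
  have mem_of_inv_mul_mem : ∀ x y, x⁻¹ * y ∈ S → f y ∈ B.image (f x * ·) := fun x y h =>
    mem_image.2 ⟨f (x⁻¹ * y), hS (mem_image_of_mem f h), by simp⟩
  refine coarseLE_sepProfile_of_connected_family (N := #B) (fun x => B.image (f x * ·))
    (fun x => ?_) (fun x y hxy => ?_) (fun x => card_image_le) fun z => ?_
  · rw [coe_image]
    exact connected_induce_image_mul_left hconn (f x)
  · obtain h | h := ((mulCayley_adj _ _ _).1 hxy).2
    · exact ⟨f y, mem_of_inv_mul_mem x y h, self_mem y⟩
    · exact ⟨f x, self_mem x, mem_of_inv_mul_mem y x h⟩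
  · rw [← hf.encard_image, ← Set.encard_coe_eq_coe_finsetCard,
      ← ((mul_left_injective z).comp inv_injective).encard_image]
    refine Set.encard_le_encard ?_
    rintro - ⟨-, ⟨x, hx, rfl⟩, rfl⟩
    obtain ⟨b, hb, rfl⟩ := mem_image.1 hx
    simpa using hb

end Comparison

section FreeProduct

open Monoid.CoprodI

variable {ι : Type*} {M : ι → Type*} [∀ i, Group (M i)]

open scoped Classical in
/-- The first letter of the reduced word of `x` if it lies in `M i`, and `1` otherwise,
which is the point of `M i` closest to `x` in the Cayley graph. -/
noncomputable def coprodHead (i : ι) (x : Monoid.CoprodI M) : M i :=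
  (Word.equivPair i (Word.equiv x)).head

lemma coprodHead_one (i : ι) : coprodHead i (1 : Monoid.CoprodI M) = 1 := by
  classical
  have h : Word.equiv (1 : Monoid.CoprodI M) = Word.empty := by simp [Word.equiv]
  rw [coprodHead, h, Word.equivPair_eq_of_fstIdx_ne]
  simp [Word.fstIdx, Word.empty]

lemma coprodHead_of_mul {i : ι} (m : M i) (x : Monoid.CoprodI M) :
    coprodHead i (of m * x) = m * coprodHead i x := by
  classical
  have h : Word.equiv (of m * x) = of m • Word.equiv x := by simp [Word.equiv, mul_smul]
  simp only [coprodHead, h, Word.equivPair_smul_same]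

lemma coprodHead_of {i : ι} (m : M i) : coprodHead i (of m) = m := by
  simpa [coprodHead_one] using coprodHead_of_mul m 1

lemma coprodHead_eq_one_of_ne {i j : ι} (hij : i ≠ j) {x : Monoid.CoprodI M}
    (h : coprodHead i x ≠ 1) : coprodHead j x = 1 := by
  classical
  have hi : (Word.equiv x).fstIdx = some i := by
    by_contra hne
    exact h (by rw [coprodHead, Word.equivPair_eq_of_fstIdx_ne hne])
  rw [coprodHead, Word.equivPair_eq_of_fstIdx_ne]
  rw [hi]
  simpa using hij

lemma coprodHead_of_of_ne {i j : ι} (hij : i ≠ j) (m : M j) :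
    coprodHead i (of m : Monoid.CoprodI M) = 1 := by
  by_cases hm : m = 1
  · rw [hm, map_one, coprodHead_one]
  · exact coprodHead_eq_one_of_ne hij.symm (by rwa [coprodHead_of])

@[elab_as_elim]
lemma coprodI_induction_reduced {p : Monoid.CoprodI M → Prop} (x : Monoid.CoprodI M) (one : p 1)
    (of_mul : ∀ (i : ι) (m : M i) (x : Monoid.CoprodI M), m ≠ 1 → coprodHead i x = 1 → p x →
      p (of m * x)) : p x := by
  classical
  obtain ⟨w, rfl⟩ := Word.equiv.symm.surjective x
  induction w using Word.consRecOn with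
  | empty => exact one
  | cons i m w hw hm ih =>
    have hcons : Word.equiv.symm (Word.cons m w hw hm) = of m * Word.equiv.symm w :=
      Word.prod_cons _ _ _ hm hw
    refine hcons ▸ of_mul i m _ hm ?_ ih
    rw [coprodHead, Word.equiv.apply_symm_apply, Word.equivPair_eq_of_fstIdx_ne hw]

lemma exists_coprodHead_ne_one {x : Monoid.CoprodI M} (hx : x ≠ 1) : ∃ i, coprodHead i x ≠ 1 := by
  induction x using coprodI_induction_reduced with
  | one => exact absurd rfl hx
  | of_mul i m x hm hhead _ => exact ⟨i, by rwa [coprodHead_of_mul, hhead, mul_one]⟩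

lemma coprodHead_mul_of (x : Monoid.CoprodI M) {j : ι} (m : M j) (i : ι) :
    coprodHead i (x * of m) = coprodHead i x ∨ (i = j ∧ ∃ g : M i, x = of g) := by
  induction x using coprodI_induction_reduced generalizing i with
  | one =>
    obtain rfl | hij := eq_or_ne i j
    · exact .inr ⟨rfl, 1, (map_one _).symm⟩
    · exact .inl (by rw [one_mul, coprodHead_one, coprodHead_of_of_ne hij])
  | of_mul k a x ha hhead ih =>
    rw [mul_assoc]
    obtain rfl | hki := eq_or_ne k i
    · obtain hx | ⟨hkj, g, rfl⟩ := ih k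
      · exact .inl (by rw [coprodHead_of_mul, coprodHead_of_mul, hx])
      · exact .inr ⟨hkj, a * g, (map_mul _ _ _).symm⟩
    · left
      rw [coprodHead_eq_one_of_ne hki (x := of a * x) (by rwa [coprodHead_of_mul, hhead, mul_one])]
      obtain hx | ⟨rfl, g, rfl⟩ := ih k
      · exact coprodHead_eq_one_of_ne hki (by rwa [coprodHead_of_mul, hx, hhead, mul_one])
      · rw [← map_mul, ← map_mul, coprodHead_of_of_ne hki.symm]

/-- The projection of a free product onto the coset `v * M i`, identified with `M i`. -/
noncomputable def cosetProj (v : Monoid.CoprodI M) (i : ι) (x : Monoid.CoprodI M) : M i :=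
  coprodHead i (v⁻¹ * x)

/-- The elements seen from `v` through its coset `v * M i`. For varying `i` these sets are the
pieces into which the removal of `v` cuts the free product. -/
def branch (v : Monoid.CoprodI M) (i : ι) : Set (Monoid.CoprodI M) :=
  {x | cosetProj v i x ≠ 1}

lemma cosetProj_mul_of (v : Monoid.CoprodI M) {i : ι} (g : M i) :
    cosetProj v i (v * of g) = g := by
  rw [cosetProj, inv_mul_cancel_left, coprodHead_of]

lemma cosetProj_self (v : Monoid.CoprodI M) (i : ι) : cosetProj v i v = 1 := by
  simpa using cosetProj_mul_of v (1 : M i)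

lemma cosetProj_mul_of_left (v : Monoid.CoprodI M) {i : ι} (g : M i) (x : Monoid.CoprodI M) :
    cosetProj (v * of g) i x = g⁻¹ * cosetProj v i x := by
  rw [cosetProj, mul_inv_rev, ← map_inv, mul_assoc, coprodHead_of_mul, cosetProj]

lemma self_notMem_branch (v : Monoid.CoprodI M) (i : ι) : v ∉ branch v i :=
  not_not.2 (cosetProj_self v i)

lemma disjoint_branch {i j : ι} (hij : i ≠ j) (v : Monoid.CoprodI M) :
    Disjoint (branch v i) (branch v j) :=
  Set.disjoint_left.2 fun _ hi hj => hj (coprodHead_eq_one_of_ne hij hi)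

lemma branch_mul_of_subset {i k : ι} (hki : k ≠ i) (v : Monoid.CoprodI M) {g : M i} (hg : g ≠ 1) :
    branch (v * of g) k ⊆ branch v i := fun x hx hxv => by
  have h : cosetProj (v * of g) i x = 1 := coprodHead_eq_one_of_ne hki hx
  rw [cosetProj_mul_of_left, hxv, mul_one, inv_eq_one] at h
  exact hg h

lemma exists_mem_branch {v x : Monoid.CoprodI M} (h : x ≠ v) : ∃ i, x ∈ branch v i :=
  exists_coprodHead_ne_one (mt inv_mul_eq_one.1 h.symm)

section CayleyGraph

variable {S : ∀ i, Finset (M i)} {U : Set (Monoid.CoprodI M)}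
  (hU : U ⊆ ⋃ i, of '' (S i : Set (M i)))

include hU

lemma cosetProj_eq_or_of_adj (v : Monoid.CoprodI M) (i : ι) {x y : Monoid.CoprodI M}
    (hxy : (mulCayley U).Adj x y) :
    cosetProj v i x = cosetProj v i y ∨ ∃ a b : M i, x = v * of a ∧ y = v * of b ∧
      (mulCayley (S i : Set (M i))).Adj a b := by
  wlog hxyU : x⁻¹ * y ∈ U generalizing x y
  · obtain h | ⟨a, b, ha, hb, hab⟩ := this hxy.symm
      (((mulCayley_adj _ _ _).1 hxy).2.resolve_left hxyU)
    · exact .inl h.symm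
    · exact .inr ⟨b, a, hb, ha, hab.symm⟩
  obtain ⟨j, s, hs, hsxy⟩ := Set.mem_iUnion.1 (hU hxyU)
  obtain rfl : y = x * of s := by rw [hsxy, mul_inv_cancel_left]
  obtain h | ⟨rfl, g, hg⟩ := coprodHead_mul_of (v⁻¹ * x) s i
  · exact .inl (by rw [cosetProj, cosetProj, ← mul_assoc, h])
  · obtain rfl : x = v * of g := by rw [← hg, mul_inv_cancel_left]
    refine .inr ⟨g, g * s, rfl, by rw [map_mul, mul_assoc], (mulCayley_adj _ _ _).2 ⟨?_, ?_⟩⟩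
    · exact fun h => hxy.ne (by rw [left_eq_mul.1 h, map_one, mul_one])
    · exact .inl (by simpa using hs)

lemma cosetProj_eq_of_connected {C : Set (Monoid.CoprodI M)}
    (hC : ((mulCayley U).induce C).Connected) {v x y : Monoid.CoprodI M} {i : ι} (hx : x ∈ C)
    (hy : y ∈ C) (hv : v * of (cosetProj v i x) ∉ C) : cosetProj v i y = cosetProj v i x := by
  refine subset_of_connected_induce (D := {y | cosetProj v i y = cosetProj v i x}) hC
    ⟨x, hx, rfl⟩ ?_ hy
  rintro a ⟨haC, ha⟩ b - hab
  obtain h | ⟨c, -, rfl, -, -⟩ := cosetProj_eq_or_of_adj hU v i hab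
  · exact h.symm.trans ha
  · rw [Set.mem_ofPred_eq, cosetProj_mul_of] at ha
    exact absurd (ha ▸ haC) hv

lemma subset_branch_of_connected {C : Set (Monoid.CoprodI M)}
    (hC : ((mulCayley U).induce C).Connected) {v x : Monoid.CoprodI M} {i : ι} (hv : v ∉ C)
    (hx : x ∈ C) (hxi : x ∈ branch v i) : C ⊆ branch v i := by
  refine subset_of_connected_induce hC ⟨x, hx, hxi⟩ ?_
  rintro a ⟨-, ha⟩ b hb hab
  obtain h | ⟨-, c, -, rfl, -⟩ := cosetProj_eq_or_of_adj hU v i hab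
  · exact fun h' => ha (h.trans h')
  · refine fun h => hv ?_
    rw [cosetProj_mul_of] at h
    rwa [h, map_one, mul_one] at hb

lemma connected_induce_image_cosetProj {C : Set (Monoid.CoprodI M)}
    (hC : ((mulCayley U).induce C).Connected) (v : Monoid.CoprodI M) (i : ι) :
    ((mulCayley (S i : Set (M i))).induce (cosetProj v i '' C)).Connected := by
  refine connected_induce_image hC fun x _ y _ hxy => ?_
  obtain h | ⟨a, b, rfl, rfl, hab⟩ := cosetProj_eq_or_of_adj hU v i hxy
  · exact .inl h
  · rw [cosetProj_mul_of, cosetProj_mul_of]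
    exact .inr hab

lemma exists_heavy_branch_mul_of {ℋ : Set (Set (Monoid.CoprodI M))} (hup : IsUpperSet ℋ)
    (hint : ℋ.Intersecting) {K : Finset (Monoid.CoprodI M)} {n m : ℕ} (hm : 0 < m) (hK : #K ≤ n)
    {i : ι} (hSi : groupSep (S i) n ≤ m) (hconn : ((mulCayley U).induce (K : Set _)).Connected)
    (hno : ∀ Z : Finset (Monoid.CoprodI M), #Z ≤ 9 * m → ¬ Separates (mulCayley U) K Z ℋ)
    {v : Monoid.CoprodI M} (hv : v ∈ K) :
    ∃ (g : M i) (k : ι), k ≠ i ∧ v * of g ∈ K ∧ branch (v * of g) k ∈ ℋ := by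
  classical
  have hinj : Function.Injective fun g : M i => v * of g :=
    (mul_right_injective v).comp (of_injective i)
  obtain ⟨Z, hZcard, hZ⟩ := exists_separates_of_sepProfile_le
    (hup.preimage Set.monotone_preimage) (intersecting_preimage_preimage hint (cosetProj v i)) hm
    hSi
    (K := K.preimage (fun g => v * of g) hinj.injOn)
    ((card_preimage ..).trans_le ((card_filter_le _ _).trans hK))
  obtain ⟨C, hCK, hCZ, hC, hCℋ⟩ := not_separates_iff.1
    (hno (Z.image fun g => v * of g) (card_image_le.trans hZcard))
  obtain ⟨x, hx, hxC⟩ : ∃ x ∈ C, v * of (cosetProj v i x) ∉ C := by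
    by_contra! hall
    refine hZ (cosetProj v i '' C) ?_ (Set.disjoint_left.2 ?_)
      (connected_induce_image_cosetProj hU hC v i) (hup (Set.subset_preimage_image _ C) hCℋ)
    · rintro - ⟨x, hx, rfl⟩
      exact mem_preimage.2 (hCK (hall x hx))
    · rintro - ⟨x, hx, rfl⟩ hxZ
      exact Set.disjoint_left.1 hCZ (hall x hx) (mem_coe.2 (mem_image_of_mem _ hxZ))
  obtain ⟨k, hk⟩ := exists_mem_branch (ne_of_mem_of_not_mem hx hxC)
  refine ⟨cosetProj v i x, k, ?_, ?_, hup (subset_branch_of_connected hU hC hxC hx hk) hCℋ⟩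
  · rintro rfl
    exact hk (by rw [cosetProj_mul_of_left, inv_mul_cancel])
  · by_contra hxK
    have h := cosetProj_eq_of_connected hU hconn (hCK hx) hv hxK
    rw [← h, cosetProj_self, map_one, mul_one] at hxK
    exact hxK hv

lemma exists_heavy_branch {ℋ : Set (Set (Monoid.CoprodI M))} (hup : IsUpperSet ℋ)
    {K : Finset (Monoid.CoprodI M)} {v : Monoid.CoprodI M}
    (hv : ¬ Separates (mulCayley U) K {v} ℋ) : ∃ i, branch v i ∈ ℋ := by
  obtain ⟨C, -, hCv, hC, hCℋ⟩ := not_separates_iff.1 hv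
  have hvC : v ∉ C := by simpa using hCv
  obtain ⟨x, hx⟩ := Set.nonempty_coe_sort.1 hC.nonempty
  obtain ⟨i, hi⟩ := exists_mem_branch (ne_of_mem_of_not_mem hx hvC)
  exact ⟨i, hup (subset_branch_of_connected hU hC hvC hx hi) hCℋ⟩

lemma exists_separates_coprodI_of_connected {ℋ : Set (Set (Monoid.CoprodI M))} (hup : IsUpperSet ℋ)
    (hint : ℋ.Intersecting) {K : Finset (Monoid.CoprodI M)} {n m : ℕ} (hm : 0 < m) (hK : #K ≤ n)
    (hS : ∀ i, groupSep (S i) n ≤ m) (hconn : ((mulCayley U).induce (K : Set _)).Connected) :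
    ∃ Z : Finset (Monoid.CoprodI M), #Z ≤ 9 * m ∧ Separates (mulCayley U) K Z ℋ := by
  classical
  by_contra! hno
  obtain ⟨v₀, hv₀⟩ := Set.nonempty_coe_sort.1 hconn.nonempty
  obtain ⟨i₀, hi₀⟩ := exists_heavy_branch hU hup (hno {v₀} (by rw [card_singleton]; omega))
  obtain ⟨⟨v, i⟩, ⟨hv, hi⟩, hmin⟩ := exists_minimalFor_of_wellFoundedLT
    (fun p : Monoid.CoprodI M × ι => p.1 ∈ K ∧ branch p.1 p.2 ∈ ℋ)
    (fun p => {x ∈ K | x ∈ branch p.1 p.2}) ⟨(v₀, i₀), hv₀, hi₀⟩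
  obtain ⟨g, k, hki, hgK, hk⟩ :=
    exists_heavy_branch_mul_of hU hup hint hm hK (hS i) hconn hno hv
  have hg : g ≠ 1 := by
    rintro rfl
    rw [map_one, mul_one] at hk
    exact hint hk hi (disjoint_branch hki v)
  have hgi : v * of g ∈ branch v i := by rwa [branch, Set.mem_ofPred_eq, cosetProj_mul_of]
  have hle := hmin (j := (v * of g, k)) ⟨hgK, hk⟩
    (monotone_filter_right K fun _ _ hx => branch_mul_of_subset hki v hg hx)
  exact self_notMem_branch _ _ (mem_filter.1 (hle (mem_filter.2 ⟨hgK, hgi⟩))).2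

end CayleyGraph

lemma groupSep_coprodI_le {S : ∀ i, Finset (M i)} {U : Finset (Monoid.CoprodI M)}
    (hU : (U : Set (Monoid.CoprodI M)) ⊆ ⋃ i, of '' (S i : Set (M i))) {n m : ℕ} (hm : 0 < m)
    (hS : ∀ i, groupSep (S i) n ≤ m) : groupSep U n ≤ 9 * m := by
  refine sepProfile_le_of_forall_separates fun K hK => ?_
  have hint := intersecting_majority K
  by_cases hempty : Separates (mulCayley (U : Set (Monoid.CoprodI M))) K ∅ (majority K)
  · exact ⟨∅, by simp, hempty⟩
  obtain ⟨K₀, hK₀, hconn, hsep⟩ := exists_connected_of_not_separates hint hempty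
  obtain ⟨Z, hZ, hZsep⟩ := exists_separates_coprodI_of_connected hU (isUpperSet_majority K) hint hm
    ((card_le_card hK₀).trans hK) hS hconn
  exact ⟨Z, hZ, hsep hZsep⟩

end FreeProduct

section CoarseComparison

open Filter

variable {f f' g h : ℕ → ℕ}

lemma coarseLE_of_le (hfg : f ≤ g) : CoarseLE f g :=
  ⟨1, fun r => by simpa using (hfg r).trans (Nat.le_succ _)⟩

lemma CoarseLE.eventually (hfg : CoarseLE f g) (hg : Monotone g) :
    ∀ᶠ C in atTop, ∀ r, f r ≤ C * g (C * r) + C := by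
  obtain ⟨C₀, hC₀⟩ := hfg
  filter_upwards [eventually_ge_atTop C₀] with C hC r
  calc f r ≤ C₀ * g (C₀ * r) + C₀ := hC₀ r
    _ ≤ C * g (C * r) + C := by gcongr; exact hg (by gcongr)

lemma CoarseLE.max (hf : CoarseLE f g) (hf' : CoarseLE f' g) (hg : Monotone g) :
    CoarseLE (fun r => max (f r) (f' r)) g := by
  obtain ⟨C, hC, hC'⟩ := ((hf.eventually hg).and (hf'.eventually hg)).exists
  exact ⟨C, fun r => max_le (hC r) (hC' r)⟩

lemma CoarseLE.trans (hfg : CoarseLE f g) (hgh : CoarseLE g h) (hh : Monotone h) :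
    CoarseLE f h := by
  obtain ⟨A, hA⟩ := hfg
  obtain ⟨B, hB⟩ := hgh
  refine ⟨A * (B + 1), fun r => ?_⟩
  calc f r ≤ A * (B * h (B * (A * r)) + B) + A := (hA r).trans (by gcongr; exact hB _)
    _ = A * B * h (A * B * r) + A * (B + 1) := by ring_nf
    _ ≤ A * (B + 1) * h (A * (B + 1) * r) + A * (B + 1) := by
      gcongr
      · omega
      · exact hh (by gcongr; omega)

end CoarseComparison

section FreeProductProfile

open Monoid.CoprodI Filter

lemma isFiniteGenSet_coprodI {ι : Type*} {M : ι → Type*} [∀ i, Group (M i)]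
    {S : ∀ i, Finset (M i)} (hS : ∀ i, IsFiniteGenSet (S i)) {U : Finset (Monoid.CoprodI M)}
    (hU : ⋃ i, of '' (S i : Set (M i)) ⊆ (U : Set (Monoid.CoprodI M))) : IsFiniteGenSet U := by
  have range_of_le : ∀ i, (of : M i →* _).range ≤ Subgroup.closure (U : Set _) := fun i => by
    rw [MonoidHom.range_eq_map, ← hS i, MonoidHom.map_closure]
    exact Subgroup.closure_mono ((Set.subset_iUnion _ i).trans hU)
  refine eq_top_iff.2 fun x _ => ?_
  induction x using Monoid.CoprodI.induction_on with
  | one => exact one_mem _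
  | of i m => exact range_of_le i ⟨m, rfl⟩
  | mul x y hx hy => exact mul_mem (hx trivial) (hy trivial)

theorem groupSep_coarseLE_of_injective_coprodI {ι : Type*} [Finite ι] {M : ι → Type*}
    [∀ i, Group (M i)] [∀ i, Group.FG (M i)] {P : Type*} [Group P] {f : P →* Monoid.CoprodI M}
    (hf : Function.Injective f) {g : ℕ → ℕ} (hg : Monotone g)
    (hM : ∀ i (S : Finset (M i)), CoarseLE (groupSep S) g) (U : Finset P) :
    CoarseLE (groupSep U) g := by
  choose S hS using fun i => Group.fg_def.1 (inferInstance : Group.FG (M i))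
  obtain ⟨U₀, hU₀⟩ := (Set.finite_iUnion fun i =>
    (S i).finite_toSet.image (of : M i →* Monoid.CoprodI M)).exists_finset_coe
  refine (groupSep_coarseLE_of_injective hf U (isFiniteGenSet_coprodI hS hU₀.ge)).trans ?_ hg
  obtain ⟨C, hC⟩ := (eventually_all.2 fun i => (hM i (S i)).eventually hg).exists
  refine ⟨9 * (C + 1), fun r => ?_⟩
  calc groupSep U₀ r ≤ 9 * (C * g (C * r) + (C + 1)) :=
        groupSep_coprodI_le hU₀.le (Nat.succ_pos _) fun i => (hC i r).trans (Nat.le_succ _)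
    _ = 9 * C * g (C * r) + 9 * (C + 1) := by ring
    _ ≤ 9 * (C + 1) * g (9 * (C + 1) * r) + 9 * (C + 1) := by
      gcongr
      · omega
      · exact hg (by gcongr; omega)

universe u v

/-- The two factors of a binary free product as a family, which lets the results on
`Monoid.CoprodI` be applied to `Monoid.Coprod`. The `ULift`s put them in a common universe. -/
def coprodFactor (G : Type u) (H : Type v) : Bool → Type (max u v)
  | true => ULift.{v} G
  | false => ULift.{u} H

variable (G : Type u) (H : Type v) [Group G] [Group H]

instance : ∀ b, Group (coprodFactor G H b)
  | true => inferInstanceAs (Group (ULift.{v} G))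
  | false => inferInstanceAs (Group (ULift.{u} H))

instance [Group.FG G] [Group.FG H] : ∀ b, Group.FG (coprodFactor G H b)
  | true => Group.fg_of_surjective (f := (MulEquiv.ulift (α := G)).symm.toMonoidHom)
    (MulEquiv.surjective _)
  | false => Group.fg_of_surjective (f := (MulEquiv.ulift (α := H)).symm.toMonoidHom)
    (MulEquiv.surjective _)

lemma exists_injective_coprod_coprodI :
    ∃ f : Monoid.Coprod G H →* Monoid.CoprodI (coprodFactor G H), Function.Injective f := by
  let eG : coprodFactor G H true ≃* G := MulEquiv.ulift
  let eH : coprodFactor G H false ≃* H := MulEquiv.ulift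
  let f : Monoid.Coprod G H →* Monoid.CoprodI (coprodFactor G H) :=
    Monoid.Coprod.lift (of.comp eG.symm.toMonoidHom) (of.comp eH.symm.toMonoidHom)
  let f' : Monoid.CoprodI (coprodFactor G H) →* Monoid.Coprod G H :=
    lift fun
      | true => Monoid.Coprod.inl.comp eG.toMonoidHom
      | false => Monoid.Coprod.inr.comp eH.toMonoidHom
  have hf : f'.comp f = .id _ := by ext <;> simp [f, f']
  exact ⟨f, Function.LeftInverse.injective (g := f') (DFunLike.congr_fun hf)⟩

variable {G H}

theorem groupSep_coprod_coarseLE {S : Finset G} {T : Finset H}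
    (hS : IsFiniteGenSet S) (hT : IsFiniteGenSet T) (U : Finset (Monoid.Coprod G H)) :
    CoarseLE (groupSep U) fun r => max (groupSep S r) (groupSep T r) := by
  have := Group.fg_def.2 ⟨S, hS⟩
  have := Group.fg_def.2 ⟨T, hT⟩
  have hmono : Monotone fun r => max (groupSep S r) (groupSep T r) :=
    (monotone_sepProfile _).max (monotone_sepProfile _)
  obtain ⟨f, hf⟩ := exists_injective_coprod_coprodI G H
  refine groupSep_coarseLE_of_injective_coprodI hf hmono (fun b R => ?_) U
  cases b with
  | true =>
    exact (groupSep_coarseLE_of_injective (f := (MulEquiv.ulift (α := G)).toMonoidHom)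
      MulEquiv.ulift.injective R hS).trans (coarseLE_of_le fun r => le_max_left _ _) hmono
  | false =>
    exact (groupSep_coarseLE_of_injective (f := (MulEquiv.ulift (α := H)).toMonoidHom)
      MulEquiv.ulift.injective R hT).trans (coarseLE_of_le fun r => le_max_right _ _) hmono

lemma group_fg_coprod [Group.FG G] [Group.FG H] : Group.FG (Monoid.Coprod G H) := by
  rw [Group.fg_def, ← Monoid.Coprod.range_inl_sup_range_inr]
  exact ((Group.fg_iff_subgroup_fg _).1 inferInstance).sup
    ((Group.fg_iff_subgroup_fg _).1 inferInstance)

end FreeProductProfile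

theorem theorem1 {G H : Type*} [Group G] [Group H] [Group.FG G] [Group.FG H] :
    Group.FG (Monoid.Coprod G H) ∧
      ∀ (S : Finset G) (T : Finset H) (U : Finset (Monoid.Coprod G H)),
        IsFiniteGenSet S → IsFiniteGenSet T → IsFiniteGenSet U →
          CoarseEquiv (groupSep U) (fun r => max (groupSep S r) (groupSep T r)) := by
  refine ⟨group_fg_coprod, fun S T U hS hT hU => ⟨groupSep_coprod_coarseLE hS hT U, ?_⟩⟩
  have hG : CoarseLE (groupSep S) (groupSep U) :=
    groupSep_coarseLE_of_injective Monoid.Coprod.inl_injective S hU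
  have hH : CoarseLE (groupSep T) (groupSep U) :=
    groupSep_coarseLE_of_injective Monoid.Coprod.inr_injective T hU
  exact hG.max hH (monotone_sepProfile _)
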